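/- For an integer $N\ge 3$ let $T^2_N$ be the two-dimensional discrete torus, i.e. the Cayley graph of the group $\mathbb{Z}/N\mathbb{Z}\times\mathbb{Z}/N\mathbb{Z}$ with generating set $\{(0,1),(0,-1),(1,0),(-1,0)\}$. For $k_1,k_2\in\mathbb{Z}/N\mathbb{Z}$ put $$\mu_N(k_1,k_2)=2\cos\frac{2k_1\pi}{N}+2\cos\frac{2k_2\pi}{N}.$$ Then for every $N\ge 3$, every nonzero eigenvalue of the adjacency matrix of $T^2_N$ has multiplicity at most $24$. The bound is attained: $\mu_{60}(24,10)$ is nonzero and is an eigenvalue of the adjacency matrix of $T^2_{60}$ of multiplicity exactly $24$. -/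

import Mathlib

/-- The discrete torus `T²_N`: the Cayley graph of `ℤ/N × ℤ/N` with generating set
`{(0, 1), (0, -1), (1, 0), (-1, 0)}`. -/
def discreteTorus (N : ℕ) : SimpleGraph (ZMod N × ZMod N) :=
  SimpleGraph.addCayley {(0, 1), (0, -1), (1, 0), (-1, 0)}

open Classical in
/-- The adjacency matrix of `T²_N`, with real entries. -/
noncomputable def torusAdjMatrix (N : ℕ) : Matrix (ZMod N × ZMod N) (ZMod N × ZMod N) ℝ :=
  (discreteTorus N).adjMatrix ℝ

/-- The multiplicity of `μ` in the spectrum of the adjacency matrix of `T²_N`, i.e. its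
multiplicity as a root of the characteristic polynomial. -/
noncomputable def torusMultiplicity (N : ℕ) [NeZero N] (μ : ℝ) : ℕ :=
  (torusAdjMatrix N).charpoly.rootMultiplicity μ

/-- The number `μ_N(k₁, k₂) = 2 cos (2 k₁ π / N) + 2 cos (2 k₂ π / N)`. -/
noncomputable def torusEigenvalue (N : ℕ) (k₁ k₂ : ZMod N) : ℝ :=
  2 * Real.cos (2 * (k₁.val : ℝ) * Real.pi / (N : ℝ)) +
    2 * Real.cos (2 * (k₂.val : ℝ) * Real.pi / (N : ℝ))

/-!
The characters of `ℤ/N × ℤ/N` diagonalise the adjacency matrix, so the multiplicity of `μ` is the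
number of pairs `(u, v)` of `N`-th roots of unity with `u + u⁻¹ + v + v⁻¹ = μ`. It suffices to find
three numbers such that every such representation of `μ ≠ 0` contains one of them among its
summands: fixing one summand leaves at most `8` pairs, and `3 * 8 = 24`.

The three numbers are found by induction on `N`. Unless `N ∣ 60`, one can write `N = q M` with
`q > 2` such that either `q` divides a power of `M` or `q ≥ 7` is a prime not dividing `M`. Sort the
summands of a representation by the value of their `M`-th power, a `q`-th root of unity. If all
summands of all representations are `2M`-th roots of unity, the induction hypothesis applies;
otherwise some summand `w₀` of a representation `s₀` has `w₀ ^ M ≠ w₀ ^ (-M)`. Applying the Galois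
action to the equality of two representations shows that the partial sums over the classes agree
when `q` divides a power of `M`, and that the difference of the partial sums over the class of `i`
is `i ^ (-n) C` for some `n` and `C` when `q` is prime to `M`. Agreeing partial sums over the
classes of `w₀` and `w₀⁻¹` force one of two numbers into the representation. If `C ≠ 0` then each
of the `q ≥ 7` classes is met by the eight summands involved, which leaves so little room that a
third number is forced. For `N ∣ 60` a computation modulo the prime `601` suffices.
-/

open Polynomial

/-! ### Sums of roots of unity -/

section VanishingSums

variable {K : Type*} [Field K]

theorem aeval_eq_zero_of_isRoot_cyclotomic {R : Type*} [CommRing R] [CharZero K] {N : ℕ}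
    (hN : 0 < N) {ζ : K} (hζ : IsPrimitiveRoot ζ N) {g : R} (hg : (cyclotomic N R).IsRoot g)
    {P : ℤ[X]} (hP : aeval ζ P = 0) : aeval g P = 0 := by
  have hdvd : cyclotomic N ℤ ∣ P := by
    rw [cyclotomic_eq_minpoly hζ hN]
    exact minpoly.isIntegrallyClosed_dvd (hζ.isIntegral hN) hP
  obtain ⟨Q, rfl⟩ := hdvd
  have hcyc : aeval g (cyclotomic N ℤ) = 0 := by
    rw [aeval_def, ← eval_map, algebraMap_int_eq, map_cyclotomic]
    exact hg
  rw [map_mul, hcyc, zero_mul]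

theorem aeval_sum_X_pow {R : Type*} [CommRing R] (a : R) (s : Multiset ℕ) :
    aeval a ((s.map (X ^ ·)).sum : ℤ[X]) = (s.map (a ^ ·)).sum := by
  simp [map_multiset_sum]

theorem sum_map_pow_eq_of_isRoot_cyclotomic {R : Type*} [CommRing R] [CharZero K] {N : ℕ}
    (hN : 0 < N) {ζ : K} (hζ : IsPrimitiveRoot ζ N) {g : R} (hg : (cyclotomic N R).IsRoot g)
    {s t : Multiset ℕ} (h : (s.map (ζ ^ ·)).sum = (t.map (ζ ^ ·)).sum) :
    (s.map (g ^ ·)).sum = (t.map (g ^ ·)).sum := by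
  have hζ0 : aeval ζ ((s.map (X ^ ·)).sum - (t.map (X ^ ·)).sum : ℤ[X]) = 0 := by
    rw [map_sub, aeval_sum_X_pow, aeval_sum_X_pow, h, sub_self]
  have hg0 := aeval_eq_zero_of_isRoot_cyclotomic hN hζ hg hζ0
  rwa [map_sub, aeval_sum_X_pow, aeval_sum_X_pow, sub_eq_zero] at hg0

theorem exists_map_pow_eq {N : ℕ} [NeZero N] {ζ : K} (hζ : IsPrimitiveRoot ζ N) {s : Multiset K}
    (hs : ∀ u ∈ s, u ^ N = 1) : ∃ e : Multiset ℕ, e.map (ζ ^ ·) = s := by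
  have : CanLift K ℕ (ζ ^ ·) (· ^ N = 1) := ⟨fun _ hu ↦
    let ⟨i, _, hi⟩ := hζ.eq_pow_of_pow_eq_one hu
    ⟨i, hi⟩⟩
  lift s to Multiset ℕ using hs with e
  exact ⟨e, rfl⟩

theorem sum_map_pow_eq_of_coprime [CharZero K] {N k : ℕ} (hN : 0 < N) {ζ : K}
    (hζ : IsPrimitiveRoot ζ N) (hk : k.Coprime N) {s t : Multiset K}
    (hs : ∀ u ∈ s, u ^ N = 1) (ht : ∀ u ∈ t, u ^ N = 1) (h : s.sum = t.sum) :
    (s.map (· ^ k)).sum = (t.map (· ^ k)).sum := by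
  have : NeZero N := ⟨hN.ne'⟩
  obtain ⟨a, rfl⟩ := exists_map_pow_eq hζ hs
  obtain ⟨b, rfl⟩ := exists_map_pow_eq hζ ht
  have hroot : (cyclotomic N K).IsRoot (ζ ^ k) :=
    (hζ.pow_of_coprime k hk).isRoot_cyclotomic hN
  simpa only [Multiset.map_map, Function.comp_def, ← pow_mul, mul_comm k] using
    sum_map_pow_eq_of_isRoot_cyclotomic hN hζ hroot h

end VanishingSums

section PowFiber

variable {K : Type*} [Field K] [DecidableEq K]

/-- The elements `u` of `s` with `u ^ M = i`, counted with multiplicity. For a multiset of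
`q * M`-th roots of unity and `i` a `q`-th root of unity these are the elements in one coset of the
group of `M`-th roots of unity. -/
def powFiber (M : ℕ) (i : K) (s : Multiset K) : Multiset K := s.filter (i = · ^ M)

theorem mem_powFiber {M : ℕ} {i u : K} {s : Multiset K} :
    u ∈ powFiber M i s ↔ u ∈ s ∧ u ^ M = i := by
  rw [powFiber, Multiset.mem_filter, eq_comm]

theorem powFiber_add (M : ℕ) (i : K) (s t : Multiset K) :
    powFiber M i (s + t) = powFiber M i s + powFiber M i t := Multiset.filter_add _ s t

theorem card_powFiber (M : ℕ) (i : K) (s : Multiset K) :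
    (powFiber M i s).card = (s.map (· ^ M)).count i := by
  rw [powFiber, Multiset.count_map]

theorem sum_range_pow_eq_ite {q : ℕ} {x : K} (hx : x ^ q = 1) :
    ∑ t ∈ Finset.range q, x ^ t = if x = 1 then (q : K) else 0 := by
  split_ifs with h1
  · simp [h1]
  · rw [geom_sum_eq h1, hx, sub_self, zero_div]

theorem sum_range_inv_pow_mul_pow {q M : ℕ} {i u : K} (hi : i ≠ 0) (hiq : i ^ q = 1)
    (hu : u ^ (q * M) = 1) :
    ∑ t ∈ Finset.range q, i⁻¹ ^ t * u ^ (1 + t * M) = if i = u ^ M then q * u else 0 := by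
  have hx : (i⁻¹ * u ^ M) ^ q = 1 := by
    rw [mul_pow, inv_pow, hiq, ← pow_mul, mul_comm M, hu, inv_one, one_mul]
  calc ∑ t ∈ Finset.range q, i⁻¹ ^ t * u ^ (1 + t * M)
      = ∑ t ∈ Finset.range q, (i⁻¹ * u ^ M) ^ t * u :=
        Finset.sum_congr rfl fun t _ ↦ by ring
    _ = if i = u ^ M then q * u else 0 := by
        rw [← Finset.sum_mul, sum_range_pow_eq_ite hx, ite_mul, zero_mul]
        simp only [inv_mul_eq_one₀ hi]

theorem sum_range_inv_pow_mul_sum_map_pow {q M : ℕ} {i : K} (hi : i ≠ 0) (hiq : i ^ q = 1)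
    {s : Multiset K} (hs : ∀ u ∈ s, u ^ (q * M) = 1) :
    ∑ t ∈ Finset.range q, i⁻¹ ^ t * (s.map (· ^ (1 + t * M))).sum = q * (powFiber M i s).sum := by
  induction s using Multiset.induction with
  | empty => simp [powFiber]
  | cons u s ih =>
    rw [Multiset.forall_mem_cons] at hs
    simp only [Multiset.map_cons, Multiset.sum_cons, mul_add, Finset.sum_add_distrib, ih hs.2,
      sum_range_inv_pow_mul_pow hi hiq hs.1, powFiber, Multiset.filter_cons, Multiset.sum_add]
    split_ifs <;> simp

variable [CharZero K] {q M : ℕ} {ζ : K} {s t : Multiset K}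

theorem sum_powFiber_eq_of_dvd_pow {k : ℕ} (hζ : IsPrimitiveRoot ζ (q * M)) (hq : q ≠ 0)
    (hM : M ≠ 0) (hqM : q ∣ M ^ k) (hs : ∀ u ∈ s, u ^ (q * M) = 1)
    (ht : ∀ u ∈ t, u ^ (q * M) = 1) (h : s.sum = t.sum) {i : K} (hi : i ^ q = 1) :
    (powFiber M i s).sum = (powFiber M i t).sum := by
  have hi0 : i ≠ 0 := (IsUnit.of_pow_eq_one hi hq).ne_zero
  have hcoprime (j : ℕ) : (1 + j * M).Coprime (q * M) := by
    have hM : (1 + j * M).Coprime M := by simp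
    exact (Nat.Coprime.of_dvd_right hqM (hM.pow_right k)).mul_right hM
  refine mul_left_cancel₀ (Nat.cast_ne_zero.mpr hq : (q : K) ≠ 0) ?_
  rw [← sum_range_inv_pow_mul_sum_map_pow hi0 hi hs, ← sum_range_inv_pow_mul_sum_map_pow hi0 hi ht]
  exact Finset.sum_congr rfl fun j _ ↦ by
    rw [sum_map_pow_eq_of_coprime (by positivity) hζ (hcoprime j) hs ht h]

theorem exists_forall_ne_coprime {p : ℕ} (hp : p.Prime) (hpM : ¬ p ∣ M) :
    ∃ n < p, ∀ j < p, j ≠ n → (1 + j * M).Coprime (p * M) := by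
  have : Fact p.Prime := ⟨hp⟩
  have hM : (M : ZMod p) ≠ 0 := by rwa [Ne, ZMod.natCast_eq_zero_iff]
  have hroot {j : ℕ} (hj : p ∣ 1 + j * M) : (j : ZMod p) = -(M : ZMod p)⁻¹ := by
    rw [← ZMod.natCast_eq_zero_iff] at hj
    push_cast at hj
    field_simp
    linear_combination hj
  refine ⟨(-(M : ZMod p)⁻¹).val, ZMod.val_lt _, fun j hj hjn ↦ Nat.Coprime.mul_right ?_ (by simp)⟩
  refine ((hp.coprime_iff_not_dvd).mpr fun hdvd ↦ hjn ?_).symm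
  rw [← hroot hdvd, ZMod.val_cast_of_lt hj]

theorem exists_sum_powFiber_sub_eq {p : ℕ} (hp : p.Prime) (hpM : ¬ p ∣ M)
    (hζ : IsPrimitiveRoot ζ (p * M)) :
    ∃ n : ℕ, ∀ s t : Multiset K, (∀ u ∈ s, u ^ (p * M) = 1) → (∀ u ∈ t, u ^ (p * M) = 1) →
      s.sum = t.sum → ∃ C : K, ∀ i : K, i ^ p = 1 →
        (powFiber M i s).sum - (powFiber M i t).sum = i⁻¹ ^ n * C := by
  obtain ⟨n, hn, hcoprime⟩ := exists_forall_ne_coprime hp hpM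
  have hM : M ≠ 0 := fun h ↦ hpM (h ▸ dvd_zero p)
  have hp0 : (p : K) ≠ 0 := Nat.cast_ne_zero.mpr hp.ne_zero
  refine ⟨n, fun s t hs ht h ↦
    ⟨(p : K)⁻¹ * ((s.map (· ^ (1 + n * M))).sum - (t.map (· ^ (1 + n * M))).sum), fun i hi ↦ ?_⟩⟩
  have hi0 : i ≠ 0 := (IsUnit.of_pow_eq_one hi hp.ne_zero).ne_zero
  refine mul_left_cancel₀ hp0 ?_
  rw [mul_sub, ← sum_range_inv_pow_mul_sum_map_pow hi0 hi hs,
    ← sum_range_inv_pow_mul_sum_map_pow hi0 hi ht, ← Finset.sum_sub_distrib,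
    Finset.sum_eq_single_of_mem n (Finset.mem_range.mpr hn)]
  · field_simp
  · intro j hj hjn
    rw [sum_map_pow_eq_of_coprime (Nat.pos_of_ne_zero (mul_ne_zero hp.ne_zero hM)) hζ
      (hcoprime j (Finset.mem_range.mp hj) hjn) hs ht h, sub_self]

end PowFiber

/-! ### Representations of an eigenvalue -/

theorem map_pair {α β : Type*} (f : α → β) (a b : α) :
    ({a, b} : Multiset α).map f = {f a, f b} := rfl

section TorusRep

variable {K : Type*} [Field K]

/-- A representation of `μ` as `u + u⁻¹ + v + v⁻¹` with `N`-th roots of unity `u` and `v`, recorded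
as the multiset of its four summands. For `K = ℂ` the representations of `μ` are the ways of writing
`μ` as an eigenvalue `μ_N(k₁, k₂)` of the torus, up to the order and the signs of `k₁` and `k₂`. -/
def IsTorusRep (N : ℕ) (μ : K) (s : Multiset K) : Prop :=
  ∃ u v : K, u ^ N = 1 ∧ v ^ N = 1 ∧ s = {u, u⁻¹} + {v, v⁻¹} ∧ s.sum = μ

namespace IsTorusRep

variable {N M : ℕ} {μ : K} {s : Multiset K}

theorem card_eq (hs : IsTorusRep N μ s) : s.card = 4 := by
  obtain ⟨u, v, -, -, rfl, -⟩ := hs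
  rfl

theorem sum_eq (hs : IsTorusRep N μ s) : s.sum = μ :=
  let ⟨_, _, _, _, _, h⟩ := hs
  h

theorem pow_eq_one (hs : IsTorusRep N μ s) : ∀ w ∈ s, w ^ N = 1 := by
  obtain ⟨u, v, hu, hv, rfl, -⟩ := hs
  simp [hu, hv]

theorem ne_zero (hN : N ≠ 0) (hs : IsTorusRep N μ s) {w : K} (hw : w ∈ s) : w ≠ 0 :=
  (IsUnit.of_pow_eq_one (hs.pow_eq_one w hw) hN).ne_zero

theorem map_inv (hs : IsTorusRep N μ s) : s.map (·⁻¹) = s := by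
  obtain ⟨u, v, -, -, rfl, -⟩ := hs
  simp only [Multiset.map_add, map_pair, inv_inv, Multiset.pair_comm u⁻¹, Multiset.pair_comm v⁻¹]

theorem exists_eq_of_mem (hs : IsTorusRep N μ s) {w : K} (hw : w ∈ s) :
    ∃ z, s = {w, w⁻¹} + {z, z⁻¹} := by
  have pair_of_mem {u : K} (h : w ∈ ({u, u⁻¹} : Multiset K)) :
      ({u, u⁻¹} : Multiset K) = {w, w⁻¹} := by
    simp only [Multiset.insert_eq_cons, Multiset.mem_cons, Multiset.mem_singleton] at h
    rcases h with rfl | rfl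
    · rfl
    · rw [inv_inv, Multiset.pair_comm]
  obtain ⟨u, v, -, -, rfl, -⟩ := hs
  rcases Multiset.mem_add.mp hw with h | h
  · exact ⟨v, by rw [pair_of_mem h]⟩
  · exact ⟨u, by rw [pair_of_mem h, add_comm]⟩

theorem of_forall_pow_eq_one (hs : IsTorusRep N μ s) (h : ∀ w ∈ s, w ^ M = 1) :
    IsTorusRep M μ s := by
  obtain ⟨u, v, -, -, rfl, hμ⟩ := hs
  exact ⟨u, v, h u (by simp), h v (by simp), rfl, hμ⟩

theorem mono (hNM : N ∣ M) (hs : IsTorusRep N μ s) : IsTorusRep M μ s :=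
  hs.of_forall_pow_eq_one fun w hw ↦ by
    obtain ⟨d, rfl⟩ := hNM
    rw [pow_mul, hs.pow_eq_one w hw, one_pow]

variable [DecidableEq K]

theorem powFiber_inv (hs : IsTorusRep N μ s) (i : K) :
    powFiber M i⁻¹ s = (powFiber M i s).map (·⁻¹) := by
  conv_lhs => rw [← hs.map_inv]
  simp only [powFiber, Multiset.filter_map, Function.comp_def, inv_pow, inv_inj]

theorem two_le_card_powFiber_one (hs : IsTorusRep N μ s) {w : K} (hw : w ∈ s) (h : w ^ M = 1) :
    2 ≤ (powFiber M 1 s).card := by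
  obtain ⟨z, rfl⟩ := hs.exists_eq_of_mem hw
  have hle : {w, w⁻¹} ≤ powFiber M 1 ({w, w⁻¹} + {z, z⁻¹}) :=
    Multiset.le_filter.mpr ⟨Multiset.le_add_right _ _, by simp [h]⟩
  exact Multiset.card_le_card hle

/-- Since `w⁻¹` lies in another fibre, at most one further summand can share the fibre of `w`. -/
theorem powFiber_eq (hs : IsTorusRep N μ s) {w : K} (hw : w ∈ s) (h : w ^ M ≠ (w ^ M)⁻¹) :
    powFiber M (w ^ M) s = {w} ∨
      ∃ z, s = {w, w⁻¹} + {z, z⁻¹} ∧ powFiber M (w ^ M) s = {w, z} := by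
  obtain ⟨z, rfl⟩ := hs.exists_eq_of_mem hw
  have filter_pair (u : K) : powFiber M (w ^ M) {u, u⁻¹} =
      (if w ^ M = u ^ M then {u} else 0) + if w ^ M = (u ^ M)⁻¹ then {u⁻¹} else 0 := by
    simp only [powFiber, Multiset.insert_eq_cons, Multiset.filter_cons, Multiset.filter_singleton,
      inv_pow, Multiset.empty_eq_zero]
  have fiber_eq : powFiber M (w ^ M) ({w, w⁻¹} + {z, z⁻¹}) =
      {w} + powFiber M (w ^ M) {z, z⁻¹} := by
    rw [powFiber_add, filter_pair, if_pos rfl, if_neg h, add_zero]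
  rw [fiber_eq, filter_pair]
  by_cases hz : w ^ M = z ^ M
  · rw [← hz, if_pos rfl, if_neg h]
    exact .inr ⟨z, rfl, rfl⟩
  by_cases hz' : w ^ M = (z ^ M)⁻¹
  · rw [if_neg hz, if_pos hz', zero_add]
    exact .inr ⟨z⁻¹, by rw [inv_inv, Multiset.pair_comm z], rfl⟩
  · rw [if_neg hz, if_neg hz']
    exact .inl rfl

theorem sum_powFiber_ne_zero (hN : N ≠ 0) (hμ : μ ≠ 0) (hs : IsTorusRep N μ s) {w : K}
    (hw : w ∈ s) (h : w ^ M ≠ (w ^ M)⁻¹) : (powFiber M (w ^ M) s).sum ≠ 0 := by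
  rcases hs.powFiber_eq hw h with h1 | ⟨z, rfl, h2⟩
  · rw [h1, Multiset.sum_singleton]
    exact hs.ne_zero hN hw
  · rw [h2, Multiset.sum_pair]
    intro hwz
    have hsum := hs.sum_eq
    rw [eq_neg_of_add_eq_zero_right hwz] at hsum
    exact hμ (hsum.symm.trans (by simp))

end IsTorusRep

/-- The product is determined as well: `(w + z) / (w⁻¹ + z⁻¹) = w * z`. -/
theorem exists_eq_or_eq_of_add_eq {c c' : K} (hc : c ≠ 0) :
    ∃ y, ∀ w z : K, w ≠ 0 → z ≠ 0 → w + z = c → w⁻¹ + z⁻¹ = c' → y = w ∨ y = z := by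
  by_cases h : ∃ w z : K, w ≠ 0 ∧ z ≠ 0 ∧ w + z = c ∧ w⁻¹ + z⁻¹ = c'
  · obtain ⟨a, b, ha, hb, hab, hab'⟩ := h
    refine ⟨a, fun w z hw hz hwz hwz' ↦ ?_⟩
    have hc' : c' ≠ 0 := by
      rw [← hab', inv_add_inv ha hb, hab]
      exact div_ne_zero hc (mul_ne_zero ha hb)
    have mul_eq {x y : K} (hx : x ≠ 0) (hy : y ≠ 0) (h : x + y = c) (h' : x⁻¹ + y⁻¹ = c') :
        x * y = c / c' := by
      rw [eq_div_iff hc', ← h', ← h]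
      field_simp
      ring
    have hprod : w * z = a * b := (mul_eq hw hz hwz hwz').trans (mul_eq ha hb hab hab').symm
    have hroot : (a - w) * (a - z) = 0 := by linear_combination hprod + a * hab - a * hwz
    simpa only [mul_eq_zero, sub_eq_zero] using hroot
  · push Not at h
    exact ⟨0, fun w z hw hz hwz hwz' ↦ (h w z hw hz hwz hwz').elim⟩

namespace IsTorusRep

variable [DecidableEq K] {q M : ℕ} {μ w₀ : K} {s₀ : Multiset K}

theorem exists_mem_or_mem_of_sum_powFiber_eq (hN : q * M ≠ 0) (hμ : μ ≠ 0)
    (hs₀ : IsTorusRep (q * M) μ s₀) (hw₀ : w₀ ∈ s₀) (hinv : w₀ ^ M ≠ (w₀ ^ M)⁻¹) :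
    ∃ c y, ∀ s, IsTorusRep (q * M) μ s →
      (∀ i, i ^ q = 1 → (powFiber M i s).sum = (powFiber M i s₀).sum) → c ∈ s ∨ y ∈ s := by
  have hroot : (w₀ ^ M) ^ q = 1 := by rw [← pow_mul, mul_comm, hs₀.pow_eq_one w₀ hw₀]
  have hc := hs₀.sum_powFiber_ne_zero hN hμ hw₀ hinv
  obtain ⟨y, hy⟩ := exists_eq_or_eq_of_add_eq (c' := (powFiber M (w₀ ^ M)⁻¹ s₀).sum) hc
  refine ⟨(powFiber M (w₀ ^ M) s₀).sum, y, fun s hs hsum ↦ ?_⟩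
  have hsum₁ := hsum (w₀ ^ M) hroot
  have hsum₂ := hsum (w₀ ^ M)⁻¹ (by rw [inv_pow, hroot, inv_one])
  obtain ⟨w, hw⟩ : ∃ w, w ∈ powFiber M (w₀ ^ M) s :=
    Multiset.exists_mem_of_ne_zero fun h0 ↦ hc (by rw [← hsum₁, h0, Multiset.sum_zero])
  obtain ⟨hws, hwM⟩ := mem_powFiber.mp hw
  rw [hs.powFiber_inv, ← hwM] at hsum₂
  rw [← hwM] at hinv hsum₁
  rcases hs.powFiber_eq hws hinv with h1 | ⟨z, rfl, h2⟩
  · rw [h1, Multiset.sum_singleton, hwM] at hsum₁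
    exact .inl (hsum₁ ▸ hws)
  · have hzs : z ∈ ({w, w⁻¹} + {z, z⁻¹} : Multiset K) := by simp
    rw [h2, Multiset.sum_pair, hwM] at hsum₁
    rw [h2, map_pair, Multiset.sum_pair, hwM] at hsum₂
    rcases hy w z (hs.ne_zero hN hws) (hs.ne_zero hN hzs) hsum₁ hsum₂ with rfl | rfl
    exacts [.inr hws, .inr hzs]

end IsTorusRep

end TorusRep

section SmallCover

variable {K : Type*} [Field K]

/-- At most three numbers meet every representation of `μ` as `u + u⁻¹ + v + v⁻¹` with `N`-th roots
of unity `u` and `v`. Fixing one summand leaves at most eight ordered pairs `(u, v)`, hence the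
bound `24 = 3 * 8`. -/
def HasSmallCover (N : ℕ) (μ : K) : Prop :=
  ∃ Y : Finset K, Y.card ≤ 3 ∧ ∀ s, IsTorusRep N μ s → ∃ w ∈ Y, w ∈ s

variable {N M q : ℕ} {μ : K}

theorem HasSmallCover.of_forall {a b c : K}
    (h : ∀ s, IsTorusRep N μ s → a ∈ s ∨ b ∈ s ∨ c ∈ s) : HasSmallCover N μ := by
  classical
  exact ⟨{a, b, c}, Finset.card_le_three, fun s hs ↦ by simpa using h s hs⟩

theorem HasSmallCover.of_dvd (hNM : N ∣ M) (h : HasSmallCover M μ) : HasSmallCover N μ := by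
  obtain ⟨Y, hY, hcover⟩ := h
  exact ⟨Y, hY, fun s hs ↦ hcover s (hs.mono hNM)⟩

theorem hasSmallCover_of_two_mul (hN : N ≠ 0) (h : HasSmallCover (2 * M) μ)
    (hbase : ∀ s₀ w₀, IsTorusRep N μ s₀ → w₀ ∈ s₀ → w₀ ^ M ≠ (w₀ ^ M)⁻¹ → HasSmallCover N μ) :
    HasSmallCover N μ := by
  by_cases hex : ∃ s₀ w₀, IsTorusRep N μ s₀ ∧ w₀ ∈ s₀ ∧ w₀ ^ M ≠ (w₀ ^ M)⁻¹
  · obtain ⟨s₀, w₀, hs₀, hw₀, hinv⟩ := hex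
    exact hbase s₀ w₀ hs₀ hw₀ hinv
  · push Not at hex
    obtain ⟨Y, hY, hcover⟩ := h
    refine ⟨Y, hY, fun s hs ↦ hcover s (hs.of_forall_pow_eq_one fun w hw ↦ ?_)⟩
    have hw0 : w ^ M ≠ 0 := pow_ne_zero M (hs.ne_zero hN hw)
    rw [mul_comm, pow_mul, sq]
    exact (mul_eq_one_iff_eq_inv₀ hw0).mpr (hex s w hs hw)

variable [CharZero K] [IsAlgClosed K]

theorem exists_isPrimitiveRoot (hN : N ≠ 0) : ∃ ζ : K, IsPrimitiveRoot ζ N :=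
  have : NeZero (N : K) := ⟨Nat.cast_ne_zero.mpr hN⟩
  HasEnoughRootsOfUnity.exists_primitiveRoot K N

theorem hasSmallCover_mul_of_dvd_pow {k : ℕ} (hq : q ≠ 0) (hM : M ≠ 0) (hqM : q ∣ M ^ k)
    (hμ : μ ≠ 0) (h : HasSmallCover (2 * M) μ) : HasSmallCover (q * M) μ := by
  classical
  have hN : q * M ≠ 0 := mul_ne_zero hq hM
  obtain ⟨ζ, hζ⟩ := exists_isPrimitiveRoot (K := K) hN
  refine hasSmallCover_of_two_mul hN h fun s₀ w₀ hs₀ hw₀ hinv ↦ ?_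
  obtain ⟨c, y, hcover⟩ := hs₀.exists_mem_or_mem_of_sum_powFiber_eq hN hμ hw₀ hinv
  refine .of_forall (c := y) fun s hs ↦ (hcover s hs fun i hi ↦ ?_).imp_right .inl
  exact sum_powFiber_eq_of_dvd_pow hζ hq hM hqM hs.pow_eq_one hs₀.pow_eq_one
    (hs.sum_eq.trans hs₀.sum_eq.symm) hi

theorem count_le_one_of_card_le {α : Type*} [DecidableEq α] {S : Finset α} {T : Multiset α}
    (hST : S.val ≤ T) (hcard : T.card ≤ S.card + 1) {a b : α} (ha : 2 ≤ T.count a) (hba : b ≠ a) :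
    T.count b ≤ 1 := by
  obtain ⟨U, rfl⟩ := Multiset.le_iff_exists_add.mp hST
  have hS (c : α) : S.val.count c ≤ 1 := Multiset.nodup_iff_count_le_one.mp S.nodup c
  have hU : U.card ≤ 1 := by simpa using hcard
  rw [Multiset.count_add] at ha ⊢
  have haU : a ∈ U := Multiset.count_pos.mp (by have := hS a; lia)
  obtain ⟨U, rfl⟩ := Multiset.exists_cons_of_mem haU
  have hbU : b ∉ a ::ₘ U := by
    have : U = 0 := by simpa using hU
    simp [this, hba]
  rw [Multiset.count_eq_zero_of_notMem hbU]
  exact hS b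

section

variable [DecidableEq K] {p : ℕ} {s s₀ : Multiset K}

/-- If the fibre sums differ, all of the `p ≥ 7` fibres are met by the eight summands of `s` and
`s₀`. The fibre of `1` is met twice by symmetry, so each other fibre is met only once. -/
theorem IsTorusRep.card_powFiber_add_card_powFiber_le_one (hp7 : 7 ≤ p) (hs : IsTorusRep N μ s)
    (hs₀ : IsTorusRep N μ s₀)
    (hne : ∀ i : K, i ^ p = 1 → (powFiber M i s).sum ≠ (powFiber M i s₀).sum) {i : K}
    (hi1 : i ≠ 1) : (powFiber M i s).card + (powFiber M i s₀).card ≤ 1 := by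
  have mem_of_root {j : K} (hj : j ^ p = 1) : ∃ w ∈ s + s₀, w ^ M = j := by
    by_contra! h
    have empty {r : Multiset K} (hr : r ≤ s + s₀) : powFiber M j r = 0 :=
      Multiset.filter_eq_nil.mpr fun w hw hjw ↦ h w (Multiset.mem_of_le hr hw) hjw.symm
    exact hne j hj (by rw [empty (Multiset.le_add_right s s₀), empty (Multiset.le_add_left s₀ s)])
  have two_le_one : 2 ≤ (powFiber M 1 (s + s₀)).card := by
    obtain ⟨w, hw, hw1⟩ := mem_of_root (one_pow p)
    rw [powFiber_add, Multiset.card_add]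
    rcases Multiset.mem_add.mp hw with hw | hw
    · exact le_add_right (hs.two_le_card_powFiber_one hw hw1)
    · exact le_add_left (hs₀.two_le_card_powFiber_one hw hw1)
  obtain ⟨ζ, hζ⟩ := exists_isPrimitiveRoot (K := K) (N := p) (by lia)
  have hsub : (nthRootsFinset p (1 : K)).val ≤ (s + s₀).map (· ^ M) :=
    Finset.val_le_iff_val_subset.mpr fun j hj ↦ by
      rw [Finset.mem_val, mem_nthRootsFinset (by lia)] at hj
      exact Multiset.mem_map.mpr (mem_of_root hj)
  rw [← Multiset.card_add, ← powFiber_add, card_powFiber]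
  rw [card_powFiber] at two_le_one
  refine count_le_one_of_card_le hsub ?_ two_le_one hi1
  rw [Multiset.card_map, Multiset.card_add, hs.card_eq, hs₀.card_eq, hζ.card_nthRootsFinset]
  lia

theorem IsTorusRep.mem_of_sum_powFiber_sub_eq (hp7 : 7 ≤ p) (hs : IsTorusRep N μ s)
    (hs₀ : IsTorusRep N μ s₀) {n : ℕ} {C : K} (hC : C ≠ 0)
    (hsub : ∀ i : K, i ^ p = 1 → (powFiber M i s).sum - (powFiber M i s₀).sum = i⁻¹ ^ n * C)
    {w₀ l : K} (hw₀ : w₀ ∈ s₀) (hw₀p : (w₀ ^ M) ^ p = 1) (hw₀1 : w₀ ^ M ≠ 1) (hl : l ^ p = 1)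
    (hl1 : l ≠ 1) (hls₀ : powFiber M l s₀ = 0) : -(w₀ ^ M * l⁻¹) ^ n * w₀ ∈ s := by
  have ne_zero {i : K} (hi : i ^ p = 1) : i ≠ 0 := (IsUnit.of_pow_eq_one hi (by lia)).ne_zero
  have hne (i : K) (hi : i ^ p = 1) : (powFiber M i s).sum ≠ (powFiber M i s₀).sum := by
    rw [← sub_ne_zero, hsub i hi]
    exact mul_ne_zero (pow_ne_zero n (inv_ne_zero (ne_zero hi))) hC
  have hw₀fib : powFiber M (w₀ ^ M) s = 0 ∧ powFiber M (w₀ ^ M) s₀ = {w₀} := by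
    have hle := hs.card_powFiber_add_card_powFiber_le_one hp7 hs₀ hne hw₀1
    obtain ⟨r, hr⟩ := Multiset.exists_cons_of_mem (mem_powFiber.mpr ⟨hw₀, rfl⟩)
    rw [hr, Multiset.card_cons] at hle
    have hr0 : r = 0 := Multiset.card_eq_zero.mp (by lia)
    exact ⟨Multiset.card_eq_zero.mp (by lia), by rw [hr, hr0, Multiset.cons_zero]⟩
  obtain ⟨w, hw⟩ : ∃ w, powFiber M l s = {w} := by
    have hle := hs.card_powFiber_add_card_powFiber_le_one hp7 hs₀ hne hl1
    have hpos : powFiber M l s ≠ 0 := fun h0 ↦ hne l hl (by rw [h0, hls₀])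
    rw [← Multiset.card_pos] at hpos
    exact Multiset.card_eq_one.mp (by lia)
  have hw₀C : -w₀ = (w₀ ^ M)⁻¹ ^ n * C := by
    simpa [hw₀fib] using hsub (w₀ ^ M) hw₀p
  have hwC : w = l⁻¹ ^ n * C := by simpa [hw, hls₀] using hsub l hl
  have hw_eq : w = -(w₀ ^ M * l⁻¹) ^ n * w₀ := by
    have hcancel : (w₀ ^ M * l⁻¹) * (w₀ ^ M)⁻¹ = l⁻¹ := by
      rw [mul_right_comm, mul_inv_cancel₀ (ne_zero hw₀p), one_mul]
    rw [hwC, neg_mul, ← mul_neg, hw₀C, ← mul_assoc, ← mul_pow, hcancel]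
  rw [← hw_eq]
  exact (mem_powFiber.mp (hw ▸ Multiset.mem_singleton_self w : w ∈ powFiber M l s)).1

theorem exists_powFiber_eq_zero {s : Multiset K} (h : s.card + 1 < p) :
    ∃ l : K, l ^ p = 1 ∧ l ≠ 1 ∧ powFiber M l s = 0 := by
  obtain ⟨ζ, hζ⟩ := exists_isPrimitiveRoot (K := K) (N := p) (by lia)
  have hcard : (insert 1 (s.map (· ^ M)).toFinset).card < (nthRootsFinset p (1 : K)).card := by
    rw [hζ.card_nthRootsFinset]
    refine lt_of_le_of_lt (Finset.card_insert_le _ _) (lt_of_le_of_lt ?_ h)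
    simpa using Multiset.toFinset_card_le (s.map (· ^ M))
  obtain ⟨l, hl, hls⟩ := Finset.exists_mem_notMem_of_card_lt_card hcard
  rw [mem_nthRootsFinset (by lia)] at hl
  simp only [Finset.mem_insert, Multiset.mem_toFinset, Multiset.mem_map, not_or] at hls
  exact ⟨l, hl, hls.1, Multiset.filter_eq_nil.mpr fun u hu hlu ↦ hls.2 ⟨u, hu, hlu.symm⟩⟩

end

theorem hasSmallCover_prime_mul {p : ℕ} (hp : p.Prime) (hp7 : 7 ≤ p) (hpM : ¬ p ∣ M)
    (hμ : μ ≠ 0) (h : HasSmallCover (2 * M) μ) : HasSmallCover (p * M) μ := by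
  classical
  have hM : M ≠ 0 := fun h0 ↦ hpM (h0 ▸ dvd_zero p)
  have hN : p * M ≠ 0 := mul_ne_zero hp.ne_zero hM
  obtain ⟨ζ, hζ⟩ := exists_isPrimitiveRoot (K := K) hN
  obtain ⟨n, hn⟩ := exists_sum_powFiber_sub_eq hp hpM hζ
  refine hasSmallCover_of_two_mul hN h fun s₀ w₀ hs₀ hw₀ hinv ↦ ?_
  have hw₀p : (w₀ ^ M) ^ p = 1 := by rw [← pow_mul, mul_comm, hs₀.pow_eq_one w₀ hw₀]
  have hw₀1 : w₀ ^ M ≠ 1 := fun h1 ↦ hinv (by rw [h1, inv_one])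
  obtain ⟨c, y, hcover⟩ := hs₀.exists_mem_or_mem_of_sum_powFiber_eq hN hμ hw₀ hinv
  obtain ⟨l, hl, hl1, hls₀⟩ : ∃ l : K, l ^ p = 1 ∧ l ≠ 1 ∧ powFiber M l s₀ = 0 :=
    exists_powFiber_eq_zero (by rw [hs₀.card_eq]; lia)
  refine .of_forall (a := c) (b := y) (c := -(w₀ ^ M * l⁻¹) ^ n * w₀) fun s hs ↦ ?_
  obtain ⟨C, hC⟩ := hn s s₀ hs.pow_eq_one hs₀.pow_eq_one (hs.sum_eq.trans hs₀.sum_eq.symm)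
  by_cases hC0 : C = 0
  · refine (hcover s hs fun i hi ↦ ?_).imp_right .inl
    rw [← sub_eq_zero, hC i hi, hC0, mul_zero]
  · exact .inr (.inr (hs.mem_of_sum_powFiber_sub_eq hp7 hs₀ hC0 hC hw₀ hw₀p hw₀1 hl hl1 hls₀))

end SmallCover

/-! ### Level sixty -/

section LevelSixty

/-- The image of `ζ ^ k + ζ ^ (60 - k)` under the reduction `ζ ↦ 154` of a primitive `60`-th root of
unity modulo `601`, as a natural number below `601`. The prime `601` is the least one congruent to
`1` modulo `60` for which no nonzero residue is the image of more than three representations. -/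
def pairResidue (k : ℕ) : ℕ := (154 ^ k + 154 ^ (60 - k)) % 601

/-- The set of the residues `pairResidue k` with `k ≤ 30`, encoded in binary so that the kernel can
test membership quickly. -/
def pairResidueMask : ℕ := ∑ k ∈ Finset.range 31, 2 ^ pairResidue k

theorem testBit_pairResidueMask : ∀ k < 31, pairResidueMask.testBit (pairResidue k) := by
  decide +kernel

theorem card_filter_testBit_le_three : ∀ v < 601, v ≠ 0 →
    ((Finset.range 31).filter fun k ↦
      pairResidueMask.testBit ((601 + v - pairResidue k) % 601) ∧
        pairResidue k ≤ (601 + v - pairResidue k) % 601).card ≤ 3 := by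
  decide +kernel

theorem card_filter_pairResidue_le_three {v : ℕ} (hv : v < 601) (hv0 : v ≠ 0) :
    ((Finset.range 31).filter fun k ↦ ∃ l ∈ Finset.range 31, pairResidue k ≤ pairResidue l ∧
      (pairResidue k + pairResidue l) % 601 = v).card ≤ 3 := by
  refine (Finset.card_le_card (Finset.monotone_filter_right _ fun k _ hk ↦ ?_)).trans
    (card_filter_testBit_le_three v hv hv0)
  obtain ⟨l, hl, hkl, hsum⟩ := hk
  have hr (j : ℕ) : pairResidue j < 601 := Nat.mod_lt _ (by norm_num)
  have hsub : (601 + v - pairResidue k) % 601 = pairResidue l := by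
    have := hr k
    have := hr l
    lia
  rw [hsub]
  exact ⟨testBit_pairResidueMask l (Finset.mem_range.mp hl), hkl⟩

theorem add_eq_thirty_of_pairResidue_add_eq_zero : ∀ k < 31, ∀ l < 31,
    (pairResidue k + pairResidue l) % 601 = 0 → k + l = 30 := by
  decide +kernel

instance fact_prime_601 : Fact (Nat.Prime 601) := ⟨by norm_num⟩

theorem isPrimitiveRoot_154 : IsPrimitiveRoot (154 : ZMod 601) 60 :=
  have hlt : ∀ l < 60, 0 < l → (154 : ZMod 601) ^ l ≠ 1 := by decide +kernel
  .mk_of_lt _ (by norm_num) (by decide +kernel) fun l hl0 hl ↦ hlt l hl hl0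

theorem natCast_pairResidue (k : ℕ) :
    (pairResidue k : ZMod 601) = 154 ^ k + 154 ^ (60 - k) := by
  rw [pairResidue, ZMod.natCast_mod]
  push_cast
  rfl

variable {K : Type*} [Field K] {μ ζ : K} {s : Multiset K}

theorem exists_pair_inv_eq (hζ : IsPrimitiveRoot ζ 60) {u : K} (hu : u ^ 60 = 1) :
    ∃ k < 31, ({u, u⁻¹} : Multiset K) = {ζ ^ k, ζ ^ (60 - k)} := by
  have inv_pow {k : ℕ} (hk : k ≤ 60) : (ζ ^ k)⁻¹ = ζ ^ (60 - k) :=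
    inv_eq_of_mul_eq_one_right (by rw [← pow_add, Nat.add_sub_cancel' hk, hζ.pow_eq_one])
  obtain ⟨k, hk, rfl⟩ := hζ.eq_pow_of_pow_eq_one hu
  rw [inv_pow hk.le]
  by_cases hk30 : k < 31
  · exact ⟨k, hk30, rfl⟩
  · exact ⟨60 - k, by lia, by rw [Nat.sub_sub_self hk.le, Multiset.pair_comm]⟩

theorem IsTorusRep.exists_exponents (hζ : IsPrimitiveRoot ζ 60) (hs : IsTorusRep 60 μ s) :
    ∃ k < 31, ∃ l < 31, pairResidue k ≤ pairResidue l ∧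
      s = ({k, 60 - k} + {l, 60 - l} : Multiset ℕ).map (ζ ^ ·) := by
  obtain ⟨u, v, hu, hv, rfl, -⟩ := hs
  obtain ⟨k, hk, hku⟩ := exists_pair_inv_eq hζ hu
  obtain ⟨l, hl, hlv⟩ := exists_pair_inv_eq hζ hv
  rw [hku, hlv]
  rcases le_total (pairResidue k) (pairResidue l) with hkl | hlk
  · exact ⟨k, hk, l, hl, hkl, rfl⟩
  · exact ⟨l, hl, k, hk, hlk, add_comm _ _⟩

theorem pairResidue_add_mod_eq [CharZero K] (hζ : IsPrimitiveRoot ζ 60) {k l k' l' : ℕ}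
    (h : (({k, 60 - k} + {l, 60 - l} : Multiset ℕ).map (ζ ^ ·)).sum =
      (({k', 60 - k'} + {l', 60 - l'} : Multiset ℕ).map (ζ ^ ·)).sum) :
    (pairResidue k + pairResidue l) % 601 = (pairResidue k' + pairResidue l') % 601 := by
  have hcast (a b : ℕ) : ((pairResidue a + pairResidue b : ℕ) : ZMod 601) =
      (({a, 60 - a} + {b, 60 - b} : Multiset ℕ).map ((154 : ZMod 601) ^ ·)).sum := by
    rw [Nat.cast_add, natCast_pairResidue, natCast_pairResidue, Multiset.map_add, Multiset.sum_add,
      map_pair, map_pair, Multiset.sum_pair, Multiset.sum_pair]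
  rw [← Nat.ModEq, ← ZMod.natCast_eq_natCast_iff, hcast, hcast]
  exact sum_map_pow_eq_of_isRoot_cyclotomic (by norm_num) hζ
    (isPrimitiveRoot_154.isRoot_cyclotomic (by norm_num)) h

theorem sum_map_pow_eq_zero_of_add_eq_thirty (hζ : IsPrimitiveRoot ζ 60) {k l : ℕ}
    (hkl : k + l = 30) : (({k, 60 - k} + {l, 60 - l} : Multiset ℕ).map (ζ ^ ·)).sum = 0 := by
  have hneg : ζ ^ 30 = -1 := (hζ.pow (by norm_num) (by norm_num)).eq_neg_one_of_two_right
  have hk : 60 - k = 30 + l := by lia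
  have hl : 60 - l = 30 + k := by lia
  rw [hk, hl, Multiset.map_add, Multiset.sum_add, map_pair, map_pair, Multiset.sum_pair,
    Multiset.sum_pair, pow_add, pow_add, hneg]
  ring

theorem hasSmallCover_sixty [CharZero K] [IsAlgClosed K] (hμ : μ ≠ 0) : HasSmallCover 60 μ := by
  classical
  obtain ⟨ζ, hζ⟩ := exists_isPrimitiveRoot (K := K) (N := 60) (by norm_num)
  by_cases hex : ∃ s, IsTorusRep 60 μ s
  · obtain ⟨s₀, hs₀⟩ := hex
    obtain ⟨k₀, hk₀, l₀, hl₀, -, rfl⟩ := hs₀.exists_exponents hζ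
    have hv : (pairResidue k₀ + pairResidue l₀) % 601 ≠ 0 := fun h0 ↦ hμ <| hs₀.sum_eq.symm.trans <|
      sum_map_pow_eq_zero_of_add_eq_thirty hζ <|
        add_eq_thirty_of_pairResidue_add_eq_zero k₀ hk₀ l₀ hl₀ h0
    have hcard := card_filter_pairResidue_le_three (Nat.mod_lt _ (by norm_num)) hv
    refine ⟨_, (Finset.card_image_le (f := (ζ ^ ·))).trans hcard, fun s hs ↦ ?_⟩
    obtain ⟨k, hk, l, hl, hkl, rfl⟩ := hs.exists_exponents hζ
    have hres := pairResidue_add_mod_eq hζ (hs.sum_eq.trans hs₀.sum_eq.symm)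
    refine ⟨ζ ^ k, Finset.mem_image_of_mem _ ?_, by simp⟩
    exact Finset.mem_filter.mpr ⟨Finset.mem_range.mpr hk, l, Finset.mem_range.mpr hl, hkl, hres⟩
  · exact ⟨∅, by simp, fun s hs ↦ (hex ⟨s, hs⟩).elim⟩

end LevelSixty

theorem dvd_sixty_or {N : ℕ} :
    N ∣ 60 ∨ 8 ∣ N ∨ 3 * 3 ∣ N ∨ 5 * 5 ∣ N ∨ ∃ p, p.Prime ∧ 7 ≤ p ∧ p ∣ N := by
  by_contra! h
  obtain ⟨h60, h8, h9, h25, h7⟩ := h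
  refine h60 ((Nat.dvd_iff_prime_pow_dvd_dvd 60 N).mpr fun p k hp hpk ↦ ?_)
  rcases Nat.eq_zero_or_pos k with rfl | hk
  · simp
  have hp7 : p < 7 := by
    by_contra! hge
    exact h7 p hp hge ((dvd_pow_self p hk.ne').trans hpk)
  have exponent_le {j : ℕ} (hj : ¬ p ^ (j + 1) ∣ N) : k ≤ j := by
    by_contra! hlt
    exact hj ((pow_dvd_pow p hlt).trans hpk)
  interval_cases p
  · exact absurd hp (by norm_num)
  · exact absurd hp (by norm_num)
  · exact (pow_dvd_pow 2 (exponent_le (j := 2) h8)).trans (by norm_num)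
  · exact (pow_dvd_pow 3 (exponent_le (j := 1) h9)).trans (by norm_num)
  · exact absurd hp (by norm_num)
  · exact (pow_dvd_pow 5 (exponent_le (j := 1) h25)).trans (by norm_num)
  · exact absurd hp (by norm_num)

theorem hasSmallCover {K : Type*} [Field K] [CharZero K] [IsAlgClosed K] {μ : K} (hμ : μ ≠ 0)
    {N : ℕ} (hN : N ≠ 0) : HasSmallCover N μ := by
  induction N using Nat.strong_induction_on with
  | _ N ih =>
  have step {q M : ℕ} (hq : 2 < q) (hqM : N = q * M) (hstep : M ≠ 0 → HasSmallCover (2 * M) μ →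
      HasSmallCover (q * M) μ) : HasSmallCover N μ := by
    subst hqM
    have hM : M ≠ 0 := right_ne_zero_of_mul hN
    exact hstep hM (ih _ (Nat.mul_lt_mul_of_pos_right hq (Nat.pos_of_ne_zero hM)) (by lia))
  have square_step {p : ℕ} (hp : 2 < p) (hpN : p * p ∣ N) : HasSmallCover N μ := by
    obtain ⟨d, rfl⟩ := hpN
    exact step hp (mul_assoc p p d) fun hM ↦
      hasSmallCover_mul_of_dvd_pow (k := 1) (by lia) hM (by simp) hμ
  rcases dvd_sixty_or (N := N) with h | ⟨d, rfl⟩ | h | h | ⟨p, hp, hp7, hpN⟩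
  · exact (hasSmallCover_sixty hμ).of_dvd h
  · refine step (q := 4) (M := 2 * d) (by norm_num) (by ring) fun hM ↦
      hasSmallCover_mul_of_dvd_pow (k := 2) (by norm_num) hM ⟨d ^ 2, by ring⟩ hμ
  · exact square_step (by norm_num) h
  · exact square_step (by norm_num) h
  · by_cases hpp : p * p ∣ N
    · exact square_step (by lia) hpp
    obtain ⟨M, rfl⟩ := hpN
    exact step (by lia) rfl fun _ ↦
      hasSmallCover_prime_mul hp hp7 (fun h ↦ hpp (mul_dvd_mul_left p h)) hμ

/-! ### Spectrum of the torus -/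

section CayleySpectrum

theorem charpoly_eq_prod_of_apply_basis {R V ι : Type*} [CommRing R] [AddCommGroup V] [Module R V]
    [Fintype ι] [Module.Finite R V] [Module.Free R V] {f : Module.End R V}
    (b : Module.Basis ι R V) {e : ι → R} (h : ∀ i, f (b i) = e i • b i) :
    f.charpoly = ∏ i, (X - C (e i)) := by
  classical
  have hdiag : LinearMap.toMatrix b b f = Matrix.diagonal e := by
    ext i j
    rw [LinearMap.toMatrix_apply, h, map_smul, b.repr_self, Finsupp.smul_single, smul_eq_mul,
      mul_one, Finsupp.single_apply, Matrix.diagonal_apply]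
    split_ifs with hji hij hij
    exacts [hji ▸ rfl, (hij hji.symm).elim, (hji hij.symm).elim, rfl]
  rw [← LinearMap.charpoly_toMatrix f b, hdiag, Matrix.charpoly_diagonal]

theorem rootMultiplicity_prod_X_sub_C {R ι : Type*} [CommRing R] [IsDomain R] [DecidableEq R]
    [Fintype ι] (e : ι → R) (μ : R) :
    (∏ i, (X - C (e i))).rootMultiplicity μ = (Finset.univ.filter fun i ↦ μ = e i).card := by
  have hprod : ∏ i, (X - C (e i)) = ((Finset.univ.val.map e).map fun a ↦ X - C a).prod := by
    rw [Multiset.map_map]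
    rfl
  rw [hprod, ← count_roots, roots_multiset_prod_X_sub_C, Multiset.count_map]
  rfl

variable {G : Type*} [AddCommGroup G] {S : Finset G}

theorem addCayley_adj_iff_sub_mem (h0 : 0 ∉ S) (hneg : ∀ g ∈ S, -g ∈ S) {x y : G} :
    (SimpleGraph.addCayley (S : Set G)).Adj x y ↔ y - x ∈ S := by
  rw [SimpleGraph.addCayley_adj']
  constructor
  · rintro ⟨-, g, hg, rfl | rfl⟩
    · simpa using hg
    · simpa using hneg g hg
  · exact fun h ↦ ⟨fun hxy ↦ h0 (by simpa [hxy] using h), y - x, h, .inl (add_sub_cancel x y)⟩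

variable [Fintype G]

theorem adjMatrix_addCayley_mulVec_addChar (h0 : 0 ∉ S) (hneg : ∀ g ∈ S, -g ∈ S)
    [DecidableRel (SimpleGraph.addCayley (S : Set G)).Adj] {R : Type*} [CommSemiring R]
    (χ : AddChar G R) :
    ((SimpleGraph.addCayley (S : Set G)).adjMatrix R).mulVec χ = (∑ g ∈ S, χ g) • ⇑χ := by
  ext x
  have hnbr : (SimpleGraph.addCayley (S : Set G)).neighborFinset x =
      S.map (addLeftEmbedding x) := by
    ext y
    rw [SimpleGraph.mem_neighborFinset, addCayley_adj_iff_sub_mem h0 hneg]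
    simp [← eq_sub_iff_add_eq']
  simp only [SimpleGraph.adjMatrix_mulVec_apply, hnbr, Finset.sum_map, addLeftEmbedding_apply,
    χ.map_add_eq_mul, Pi.smul_apply, smul_eq_mul, ← Finset.mul_sum, mul_comm]

theorem charpoly_adjMatrix_addCayley [DecidableEq G] (h0 : 0 ∉ S) (hneg : ∀ g ∈ S, -g ∈ S)
    [DecidableRel (SimpleGraph.addCayley (S : Set G)).Adj] :
    ((SimpleGraph.addCayley (S : Set G)).adjMatrix ℂ).charpoly =
      ∏ χ : AddChar G ℂ, (X - C (∑ g ∈ S, χ g)) := by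
  rw [← Matrix.charpoly_toLin']
  refine charpoly_eq_prod_of_apply_basis (AddChar.complexBasis G) fun χ ↦ ?_
  rw [AddChar.complexBasis_apply, Matrix.toLin'_apply, adjMatrix_addCayley_mulVec_addChar h0 hneg]

end CayleySpectrum

section TorusSpectrum

open ZMod (stdAddChar)

variable {N : ℕ} [NeZero N]

theorem stdAddChar_add_inv (k : ZMod N) :
    stdAddChar k + (stdAddChar k)⁻¹ =
      ((2 * Real.cos (2 * (k.val : ℝ) * Real.pi / (N : ℝ)) : ℝ) : ℂ) := by
  have hk : stdAddChar k = Complex.exp (2 * Real.pi * Complex.I * k.val / N) := by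
    simpa using ZMod.stdAddChar_coe (N := N) k.val
  rw [hk, ← Complex.exp_neg, Complex.ofReal_mul, Complex.ofReal_cos, Complex.ofReal_ofNat,
    Complex.two_cos]
  push_cast
  ring_nf

theorem ofReal_torusEigenvalue (k l : ZMod N) :
    (torusEigenvalue N k l : ℂ) =
      (stdAddChar k + (stdAddChar k)⁻¹) + (stdAddChar l + (stdAddChar l)⁻¹) := by
  rw [torusEigenvalue, Complex.ofReal_add, stdAddChar_add_inv, stdAddChar_add_inv]

/-- The character `(x, y) ↦ exp (2 π i (k₁ x + k₂ y) / N)` of `ℤ/N × ℤ/N`. -/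
noncomputable def torusChar (k : ZMod N × ZMod N) : AddChar (ZMod N × ZMod N) ℂ :=
  stdAddChar.compAddMonoidHom ((AddMonoidHom.mulLeft k.1).coprod (AddMonoidHom.mulLeft k.2))

theorem torusChar_apply (k x : ZMod N × ZMod N) :
    torusChar k x = stdAddChar (k.1 * x.1 + k.2 * x.2) := rfl

theorem torusChar_bijective :
    Function.Bijective (torusChar : ZMod N × ZMod N → AddChar (ZMod N × ZMod N) ℂ) := by
  refine (Fintype.bijective_iff_injective_and_card _).mpr ⟨fun k l h ↦ ?_, AddChar.card_eq.symm⟩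
  have h₁ := DFunLike.congr_fun h (1, 0)
  have h₂ := DFunLike.congr_fun h (0, 1)
  simp only [torusChar_apply, mul_one, mul_zero, add_zero, zero_add] at h₁ h₂
  exact Prod.ext (ZMod.injective_stdAddChar h₁) (ZMod.injective_stdAddChar h₂)

theorem charpoly_torusAdjMatrix (hN : 3 ≤ N) :
    (torusAdjMatrix N).charpoly =
      ∏ k : ZMod N × ZMod N, (X - C (torusEigenvalue N k.1 k.2)) := by
  classical
  have : Fact (2 < N) := ⟨hN⟩
  have : Fact (1 < N) := ⟨by lia⟩
  have hone : (0 : ZMod N) ≠ 1 := zero_ne_one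
  have hneg : (1 : ZMod N) ≠ -1 := ZMod.neg_one_ne_one.symm
  let S : Finset (ZMod N × ZMod N) := {(0, 1), (0, -1), (1, 0), (-1, 0)}
  have hgraph : discreteTorus N = SimpleGraph.addCayley (S : Set (ZMod N × ZMod N)) := by
    simp [discreteTorus, S]
  have hmap : (torusAdjMatrix N).map Complex.ofRealHom =
      (SimpleGraph.addCayley (S : Set (ZMod N × ZMod N))).adjMatrix ℂ := by
    ext x y
    simp [torusAdjMatrix, hgraph, SimpleGraph.adjMatrix_apply, apply_ite]
  have hsum (k : ZMod N × ZMod N) : ∑ g ∈ S, torusChar k g = torusEigenvalue N k.1 k.2 := by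
    rw [Finset.sum_insert (by simp [hone, hneg]), Finset.sum_insert (by simp [hone]),
      Finset.sum_pair (by simp [hneg]), ofReal_torusEigenvalue]
    simp only [torusChar_apply, mul_zero, zero_add, add_zero, mul_neg, mul_one,
      AddChar.map_neg_eq_inv]
    ring
  refine map_injective Complex.ofRealHom Complex.ofRealHom.injective ?_
  rw [← Matrix.charpoly_map, hmap, charpoly_adjMatrix_addCayley
    (by simp [S, Prod.ext_iff, hone]) (by simp [S]), Polynomial.map_prod]
  refine (Fintype.prod_bijective torusChar torusChar_bijective _ _ fun k ↦ ?_).symm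
  rw [hsum, Polynomial.map_sub, map_X, map_C, Complex.ofRealHom_eq_coe]

theorem torusMultiplicity_eq_card (hN : 3 ≤ N) (μ : ℝ) :
    torusMultiplicity N μ =
      (Finset.univ.filter fun k : ZMod N × ZMod N ↦ μ = torusEigenvalue N k.1 k.2).card := by
  rw [torusMultiplicity, charpoly_torusAdjMatrix hN, rootMultiplicity_prod_X_sub_C]

theorem card_le_torusMultiplicity (hN : 3 ≤ N) {μ : ℝ} {S : Finset (ZMod N × ZMod N)}
    (hS : ∀ a ∈ S, torusEigenvalue N a.1 a.2 = μ) : S.card ≤ torusMultiplicity N μ := by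
  rw [torusMultiplicity_eq_card hN]
  exact Finset.card_le_card fun a ha ↦
    Finset.mem_filter.mpr ⟨Finset.mem_univ a, (hS a ha).symm⟩

end TorusSpectrum

section UpperBound

variable {K : Type*} [Field K]

theorem exists_card_le_two_of_add_inv_eq (c : K) :
    ∃ F : Finset K, F.card ≤ 2 ∧ ∀ v, v ≠ 0 → v + v⁻¹ = c → v ∈ F := by
  classical
  by_cases h : ∃ w : K, w ≠ 0 ∧ w + w⁻¹ = c
  · obtain ⟨w, hw, rfl⟩ := h
    refine ⟨{w, w⁻¹}, Finset.card_le_two, fun v hv hvw ↦ ?_⟩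
    have hroot : (v - w) * (v - w⁻¹) = 0 := by
      field_simp at hvw ⊢
      linear_combination hvw
    simpa only [Finset.mem_insert, Finset.mem_singleton, mul_eq_zero, sub_eq_zero] using hroot
  · exact ⟨∅, by simp, fun v hv hvc ↦ (h ⟨v, hv, hvc⟩).elim⟩

theorem HasSmallCover.exists_card_le {N : ℕ} {μ : K} (hN : N ≠ 0) (h : HasSmallCover N μ) :
    ∃ P : Finset (K × K), P.card ≤ 24 ∧
      ∀ u v, u ^ N = 1 → v ^ N = 1 → u + u⁻¹ + (v + v⁻¹) = μ → (u, v) ∈ P := by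
  classical
  obtain ⟨Y, hY, hcover⟩ := h
  choose F hF hmem using exists_card_le_two_of_add_inv_eq (K := K)
  let block (w : K) : Finset (K × K) :=
    F (w + w⁻¹) ×ˢ F (μ - (w + w⁻¹)) ∪ F (μ - (w + w⁻¹)) ×ˢ F (w + w⁻¹)
  have card_block (w : K) : (block w).card ≤ 8 := by
    refine (Finset.card_union_le _ _).trans ?_
    rw [Finset.card_product, Finset.card_product]
    nlinarith [hF (w + w⁻¹), hF (μ - (w + w⁻¹))]
  refine ⟨Y.biUnion block, (Finset.card_biUnion_le_card_mul Y block 8 fun w _ ↦ card_block w).trans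
    (by lia), fun u v hu hv huv ↦ ?_⟩
  have hu0 : u ≠ 0 := (IsUnit.of_pow_eq_one hu hN).ne_zero
  have hv0 : v ≠ 0 := (IsUnit.of_pow_eq_one hv hN).ne_zero
  obtain ⟨w, hwY, hw⟩ := hcover ({u, u⁻¹} + {v, v⁻¹}) ⟨u, v, hu, hv, rfl, by
    rw [Multiset.sum_add, Multiset.sum_pair, Multiset.sum_pair, huv]⟩
  have hpair : w + w⁻¹ = u + u⁻¹ ∨ w + w⁻¹ = v + v⁻¹ := by
    simp only [Multiset.mem_add, Multiset.insert_eq_cons, Multiset.mem_cons,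
      Multiset.mem_singleton] at hw
    rcases hw with (rfl | rfl) | (rfl | rfl) <;> simp [add_comm]
  refine Finset.mem_biUnion.mpr ⟨w, hwY, Finset.mem_union.mpr ?_⟩
  refine hpair.imp (fun hwu ↦ ?_) fun hwv ↦ ?_
  · exact Finset.mk_mem_product (hmem _ u hu0 hwu.symm) (hmem _ v hv0 (by rw [hwu, ← huv]; ring))
  · exact Finset.mk_mem_product (hmem _ u hu0 (by rw [hwv, ← huv]; ring)) (hmem _ v hv0 hwv.symm)

theorem torusMultiplicity_le {N : ℕ} [NeZero N] (hN : 3 ≤ N) {μ : ℝ} (hμ : μ ≠ 0) :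
    torusMultiplicity N μ ≤ 24 := by
  obtain ⟨P, hP, hmem⟩ :=
    (hasSmallCover (Complex.ofReal_ne_zero.mpr hμ) (NeZero.ne N)).exists_card_le (NeZero.ne N)
  have pow_eq_one (k : ZMod N) : ZMod.stdAddChar k ^ N = 1 := by
    rw [← AddChar.map_nsmul_eq_pow, nsmul_eq_mul, ZMod.natCast_self, zero_mul,
      AddChar.map_zero_eq_one]
  have hinj : Function.Injective (Prod.map ZMod.stdAddChar ZMod.stdAddChar :
      ZMod N × ZMod N → ℂ × ℂ) :=
    ZMod.injective_stdAddChar.prodMap ZMod.injective_stdAddChar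
  rw [torusMultiplicity_eq_card hN]
  refine (Finset.card_le_card_of_injOn _ (fun k hk ↦ ?_) hinj.injOn).trans hP
  refine hmem _ _ (pow_eq_one k.1) (pow_eq_one k.2) ?_
  rw [← ofReal_torusEigenvalue, ← (Finset.mem_filter.mp (Finset.mem_coe.mp hk)).2]

end UpperBound

section Attained

theorem torusEigenvalue_comm (N : ℕ) (k l : ZMod N) :
    torusEigenvalue N k l = torusEigenvalue N l k := add_comm _ _

theorem torusEigenvalue_neg_left {N : ℕ} [NeZero N] (k l : ZMod N) :
    torusEigenvalue N (-k) l = torusEigenvalue N k l := by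
  rw [← Complex.ofReal_inj, ofReal_torusEigenvalue, ofReal_torusEigenvalue, AddChar.map_neg_eq_inv,
    inv_inv, add_comm (ZMod.stdAddChar k)⁻¹]

/-- The pairs `(k', l')` that the invariance of `μ_N` under sign changes and under exchanging the
two arguments relates to `(k, l)`. -/
def torusOrbit {N : ℕ} (k l : ZMod N) : Finset (ZMod N × ZMod N) :=
  {k, -k} ×ˢ {l, -l} ∪ {l, -l} ×ˢ {k, -k}

theorem torusEigenvalue_of_mem_torusOrbit {N : ℕ} [NeZero N] {k l : ZMod N} {a : ZMod N × ZMod N}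
    (ha : a ∈ torusOrbit k l) : torusEigenvalue N a.1 a.2 = torusEigenvalue N k l := by
  have neg_right (k l : ZMod N) : torusEigenvalue N k (-l) = torusEigenvalue N k l := by
    rw [torusEigenvalue_comm, torusEigenvalue_neg_left, torusEigenvalue_comm]
  have sign {k l i j : ZMod N} (hi : i = k ∨ i = -k) (hj : j = l ∨ j = -l) :
      torusEigenvalue N i j = torusEigenvalue N k l := by
    rcases hi with rfl | rfl <;> rcases hj with rfl | rfl <;>
      simp only [torusEigenvalue_neg_left, neg_right]
  simp only [torusOrbit, Finset.mem_union, Finset.mem_product, Finset.mem_insert,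
    Finset.mem_singleton] at ha
  rcases ha with ⟨h₁, h₂⟩ | ⟨h₁, h₂⟩
  · exact sign h₁ h₂
  · rw [torusEigenvalue_comm, sign h₂ h₁]

theorem cos_three_pi_div_five : Real.cos (3 * Real.pi / 5) = (1 - √5) / 4 := by
  have h5 : √5 ^ 2 = 5 := Real.sq_sqrt (by norm_num)
  rw [show 3 * Real.pi / 5 = Real.pi - 2 * (Real.pi / 5) by ring, Real.cos_pi_sub, Real.cos_two_mul,
    Real.cos_pi_div_five]
  linear_combination (-1 / 8) * h5

theorem torusEigenvalue_sixty_24_10 : torusEigenvalue 60 24 10 = (1 - √5) / 2 := by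
  have h24 : (24 : ZMod 60).val = 24 := rfl
  have h10 : (10 : ZMod 60).val = 10 := rfl
  rw [torusEigenvalue, h24, h10]
  push_cast
  rw [show 2 * 24 * Real.pi / 60 = Real.pi - Real.pi / 5 by ring,
    show 2 * 10 * Real.pi / 60 = Real.pi / 3 by ring, Real.cos_pi_sub, Real.cos_pi_div_five,
    Real.cos_pi_div_three]
  ring

theorem torusEigenvalue_sixty_18_15 : torusEigenvalue 60 18 15 = (1 - √5) / 2 := by
  have h18 : (18 : ZMod 60).val = 18 := rfl
  have h15 : (15 : ZMod 60).val = 15 := rfl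
  rw [torusEigenvalue, h18, h15]
  push_cast
  rw [show 2 * 18 * Real.pi / 60 = 3 * Real.pi / 5 by ring,
    show 2 * 15 * Real.pi / 60 = Real.pi / 2 by ring, cos_three_pi_div_five, Real.cos_pi_div_two]
  ring

theorem torusEigenvalue_sixty_8_28 : torusEigenvalue 60 8 28 = (1 - √5) / 2 := by
  have h8 : (8 : ZMod 60).val = 8 := rfl
  have h28 : (28 : ZMod 60).val = 28 := rfl
  rw [torusEigenvalue, h8, h28, ← mul_add, Real.cos_add_cos]
  push_cast
  rw [show (2 * 8 * Real.pi / 60 + 2 * 28 * Real.pi / 60) / 2 = 3 * Real.pi / 5 by ring,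
    show (2 * 8 * Real.pi / 60 - 2 * 28 * Real.pi / 60) / 2 = -(Real.pi / 3) by ring,
    Real.cos_neg, cos_three_pi_div_five, Real.cos_pi_div_three]
  ring

theorem torusEigenvalue_sixty_24_10_ne_zero : torusEigenvalue 60 24 10 ≠ 0 := by
  have h5 : (1 : ℝ) < √5 := Real.lt_sqrt_of_sq_lt (by norm_num)
  rw [torusEigenvalue_sixty_24_10]
  linarith

theorem le_torusMultiplicity_sixty : 24 ≤ torusMultiplicity 60 (torusEigenvalue 60 24 10) := by
  have hcard : (torusOrbit 24 10 ∪ torusOrbit 18 15 ∪ torusOrbit 8 28 :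
      Finset (ZMod 60 × ZMod 60)).card = 24 := by decide +kernel
  refine hcard.ge.trans (card_le_torusMultiplicity (by norm_num) fun a ha ↦ ?_)
  rw [Finset.mem_union, Finset.mem_union] at ha
  rw [torusEigenvalue_sixty_24_10]
  rcases ha with (ha | ha) | ha <;> rw [torusEigenvalue_of_mem_torusOrbit ha]
  exacts [torusEigenvalue_sixty_24_10, torusEigenvalue_sixty_18_15, torusEigenvalue_sixty_8_28]

end Attained

theorem proposition2p4 :
    (∀ (N : ℕ) [NeZero N], 3 ≤ N →
      ∀ μ : ℝ, Module.End.HasEigenvalue (Matrix.toLin' (torusAdjMatrix N)) μ → μ ≠ 0 →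
        torusMultiplicity N μ ≤ 24) ∧
    torusEigenvalue 60 24 10 ≠ 0 ∧
    torusMultiplicity 60 (torusEigenvalue 60 24 10) = 24 :=
  ⟨fun _ _ hN _ _ hμ ↦ torusMultiplicity_le hN hμ, torusEigenvalue_sixty_24_10_ne_zero,
    (torusMultiplicity_le (by norm_num) torusEigenvalue_sixty_24_10_ne_zero).antisymm
      le_torusMultiplicity_sixty⟩
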